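/- Let $\mathbf{Loc}$ be the category of locales (the opposite of the category of frames and frame homomorphisms) and let $\Omega \colon \mathbf{Top} \to \mathbf{Loc}$ be the functor sending a space to its frame of open sets. Write $I = [0,1]$ and put $$\mathcal{I}_{\mathbf{Loc}} = \{\Omega(\partial I^n \hookrightarrow I^n)\}_{n \ge 0}, \qquad \mathcal{J}_{\mathbf{Loc}} = \{\Omega(I^n \times \{0\} \hookrightarrow I^n \times I)\}_{n \ge 0}.$$ For a class $\mathcal{W}$ of maps of $\mathbf{Loc}$, let $cell(\mathcal{W})$ be the class of transfinite compositions of pushouts of (small) coproducts of maps in $\mathcal{W}$. Say that a locale $A$ is $\omega$-small relative to a class $\mathcal{D}$ of maps if for every limit ordinal $\lambda > 0$ and every colimit-preserving sequence $X \colon \lambda \to \mathbf{Loc}$ with $X_\beta \to X_{\beta+1}$ in $\mathcal{D}$ for all $\beta < \lambda$, the canonical map $$\operatorname{colim}_{\beta<\lambda} \mathbf{Loc}(A, X_\beta) \to \mathbf{Loc}(A, \operatorname{colim}_{\beta<\lambda} X_\beta)$$ is a bijection. Proposition. For every compact Hausdorff space $K$, the locale $\Omega K$ is $\omega$-small relative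 to $cell(\mathcal{I}_{\mathbf{Loc}})$ and relative to $cell(\mathcal{J}_{\mathbf{Loc}})$. In particular, every map from $\Omega K$ to the colimit of a sequence $X_0 \to X_1 \to \cdots$ of pushouts of coproducts of maps in $\mathcal{I}_{\mathbf{Loc}}$ (or of maps in $\mathcal{J}_{\mathbf{Loc}}$) factors through some $X_n$; and for all $n \ge 0$, $\Omega(\partial I^n)$ is $\omega$-small relative to $cell(\mathcal{I}_{\mathbf{Loc}})$ and $\Omega(I^n)$ is $\omega$-small relative to $cell(\mathcal{J}_{\mathbf{Loc}})$. -/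

import Mathlib

open CategoryTheory

universe w v u

/-- The class `cell(W)` of relative `W`-cell complexes: transfinite compositions of pushouts of
coproducts of maps in `W`. The coproducts and the transfinite compositions are indexed by types in
`Type w`. -/
def cell {C : Type u} [Category.{v} C] (W : MorphismProperty C) : MorphismProperty C :=
  MorphismProperty.transfiniteCompositions.{w} (MorphismProperty.coproducts.{w} W).pushouts

/-- `A` is `ω`-small (also called finite) relative to the class of maps `D`: for every limit
ordinal `λ` (here a well-order `J` in `Type w`, nonempty and without maximum) and every
colimit-preserving `λ`-sequence `F` whose successive maps `F j ⟶ F (j + 1)` lie in `D`, the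
canonical map `colim Hom(A, F j) → Hom(A, colim F)` is a bijection. -/
def IsOmegaSmallRelativeTo {C : Type u} [Category.{v} C] (A : C) (D : MorphismProperty C) : Prop :=
  ∀ (J : Type w) [LinearOrder J] [SuccOrder J] [OrderBot J] [WellFoundedLT J] [NoMaxOrder J]
    (F : J ⥤ C) [F.IsWellOrderContinuous],
    (∀ j : J, D (F.map (homOfLE (Order.le_succ j)))) →
      Limits.PreservesColimit F (coyoneda.obj (Opposite.op A))

/-- A set `S` in a topological space `Y`, with its subspace topology, as an object of
`TopCat.{u}`. -/
abbrev subspaceTop {Y : Type} [TopologicalSpace Y] (S : Set Y) : TopCat.{u} :=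
  TopCat.of (ULift.{u} S)

/-- The inclusion of a subspace `S` of `Y` into `Y`. -/
def subspaceIncl {Y : Type} [TopologicalSpace Y] (S : Set Y) :
    subspaceTop.{u} S ⟶ TopCat.of (ULift.{u} Y) :=
  TopCat.ofHom
    { toFun := fun x => ULift.up x.down.1
      continuous_toFun :=
        continuous_uliftUp.comp (continuous_subtype_val.comp continuous_uliftDown) }

/-- The cube `I^n`. -/
abbrev cubeTop (n : ℕ) : TopCat.{u} := TopCat.of (ULift.{u} (Fin n → unitInterval))

/-- The boundary `∂I^n`: points of the cube with some coordinate equal to `0` or `1`. -/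
abbrev cubeBoundaryTop (n : ℕ) : TopCat.{u} := subspaceTop.{u} (Cube.boundary (Fin n))

/-- The inclusion `i_n : ∂I^n ⟶ I^n`. -/
def cubeBoundaryIncl (n : ℕ) : cubeBoundaryTop.{u} n ⟶ cubeTop.{u} n :=
  subspaceIncl (Cube.boundary (Fin n))

/-- The inclusion `j_n : I^n × {0} ⟶ I^n × I`. -/
def cubeBaseIncl (n : ℕ) :
    subspaceTop.{u} {p : (Fin n → unitInterval) × unitInterval | p.2 = 0} ⟶
      TopCat.of (ULift.{u} ((Fin n → unitInterval) × unitInterval)) :=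
  subspaceIncl {p : (Fin n → unitInterval) × unitInterval | p.2 = 0}

/-- The class `{Ω i_n : Ω ∂I^n ⟶ Ω I^n | n ≥ 0}` of maps of locales. -/
def locI : MorphismProperty Locale.{u} :=
  MorphismProperty.ofHoms fun n : ℕ => topToLocale.map (cubeBoundaryIncl.{u} n)

/-- The class `{Ω j_n : Ω (I^n × {0}) ⟶ Ω (I^n × I) | n ≥ 0}` of maps of locales. -/
def locJ : MorphismProperty Locale.{u} :=
  MorphismProperty.ofHoms fun n : ℕ => topToLocale.map (cubeBaseIncl.{u} n)

/-! The proof is pointfree on the side of the cell complexes and uses points only in `K`. A map `f :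
A ⟶ B` is good (`separatedClosed`) if disjoint opens of `A` extend to disjoint opens of `B` and `f`
determines each open of `B` up to `separated f`, a substitute for the complement of `A`. The
generators are good because metric spaces are completely normal and regular. Goodness survives
cobase change, coproducts and transfinite composition, so each stage `X_i ⟶ X` of a cell sequence is
good.

A map `g` from `Ω K` to `X` factors through `X_i` as soon as its preimage map kills the complement
of `X_i` (`separatedClosed.exists_lift`). If no stage works, there are `j_0 < j_1 < ...`, opens
`N_n` containing `X_{j_n}`, and points `x_n` of `K` outside the preimages of both `N_n` and the
complement of `X_{j_{n+1}}`. By `exists_cover`, `X` has an increasing cover whose `n`-th term lies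
in the join of these two opens. By compactness one term pulls back to all of `K`, yet it misses
`x_n`. -/

namespace Locale

/-- The inverse image map of a map of locales, as a frame homomorphism. -/
def preimage {A B : Locale.{u}} (f : A ⟶ B) : FrameHom B A :=
  Frm.Hom.hom (Quiver.Hom.unop f)

/-- The map of locales with a given inverse image map. -/
def homOfPreimage {A B : Locale.{u}} (φ : FrameHom B A) : A ⟶ B :=
  Quiver.Hom.op (Frm.ofHom φ)

@[simp]
lemma preimage_id_apply {A : Locale.{u}} (a : A) : preimage (𝟙 A) a = a := rfl

@[simp]
lemma preimage_comp_apply {A B C : Locale.{u}} (f : A ⟶ B) (g : B ⟶ C) (c : C) :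
    preimage (f ≫ g) c = preimage f (preimage g c) := rfl

lemma hom_ext {A B : Locale.{u}} {f g : A ⟶ B} (h : ∀ b : B, preimage f b = preimage g b) :
    f = g :=
  Quiver.Hom.unop_inj (Frm.ext h)

lemma preimage_mono {A B : Locale.{u}} (f : A ⟶ B) {b b' : B} (h : b ≤ b') :
    preimage f b ≤ preimage f b' := OrderHomClass.mono (preimage f) h

end Locale

lemma Disjoint.frameHom_map {K L : Type*} [Order.Frame K] [Order.Frame L] {a b : K}
    (h : Disjoint a b) (φ : FrameHom K L) : Disjoint (φ a) (φ b) := by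
  rw [disjoint_iff, ← map_inf, h.eq_bot, map_bot]

/-! ### Classifying locales for disjoint pairs of opens -/

section LowerSetLift

variable {P L : Type*} [PartialOrder P] [Order.Frame L]

/-- The frame homomorphism out of the frame of lower sets of `P` which extends a flat map `x`. -/
def lowerSetLift (x : P → L) (htop : ⨆ p, x p = ⊤)
    (hinf : ∀ p q, x p ⊓ x q ≤ ⨆ r : {r // r ≤ p ∧ r ≤ q}, x r) : FrameHom (LowerSet P) L where
  toFun s := ⨆ p : {p // p ∈ s}, x p
  map_inf' s t := by
    apply le_antisymm
    · exact iSup_le fun p => le_inf (le_iSup_of_le ⟨p.1, p.2.1⟩ le_rfl)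
        (le_iSup_of_le ⟨p.1, p.2.2⟩ le_rfl)
    · rw [iSup_inf_iSup]
      refine iSup_le fun pq => (hinf _ _).trans (iSup_le fun r => ?_)
      exact le_iSup_of_le (f := fun p : {p // p ∈ s ⊓ t} => x p)
        ⟨r.1, s.lower r.2.1 pq.1.2, t.lower r.2.2 pq.2.2⟩ le_rfl
  map_top' := by
    rw [← htop]
    exact le_antisymm (iSup_le fun p => le_iSup x p.1)
      (iSup_le fun p => le_iSup_of_le ⟨p, trivial⟩ le_rfl)
  map_sSup' S := by
    rw [sSup_image]
    apply le_antisymm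
    · refine iSup_le fun p => ?_
      obtain ⟨s, hs, hp⟩ := LowerSet.mem_sSup_iff.1 p.2
      exact le_iSup₂_of_le s hs (le_iSup_of_le ⟨p.1, hp⟩ le_rfl)
    · exact iSup₂_le fun s hs => iSup_le fun p =>
        le_iSup_of_le ⟨p.1, LowerSet.mem_sSup_iff.2 ⟨s, hs, p.2⟩⟩ le_rfl

lemma lowerSetLift_Iic (x : P → L) (hx : Monotone x) (htop : ⨆ p, x p = ⊤)
    (hinf : ∀ p q, x p ⊓ x q ≤ ⨆ r : {r // r ≤ p ∧ r ≤ q}, x r) (p : P) :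
    lowerSetLift x htop hinf (LowerSet.Iic p) = x p :=
  le_antisymm (iSup_le fun q => hx q.2) (le_iSup_of_le ⟨p, le_rfl⟩ le_rfl)

lemma frameHom_lowerSet_ext {f g : FrameHom (LowerSet P) L}
    (h : ∀ p, f (LowerSet.Iic p) = g (LowerSet.Iic p)) : f = g := by
  ext s
  have hs : s = ⨆ p : {p // p ∈ s}, LowerSet.Iic p.1 := by
    ext q
    simp only [LowerSet.mem_iSup_iff, LowerSet.mem_Iic_iff, SetLike.mem_coe]
    exact ⟨fun hq => ⟨⟨q, hq⟩, le_rfl⟩, fun ⟨p, hp⟩ => s.lower hp p.2⟩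
  rw [hs, map_iSup, map_iSup]
  simp [h]

end LowerSetLift

/-- The poset with two incomparable elements below a top element. -/
inductive Wedge : Type u
  | top
  | left
  | right

namespace Wedge

instance : PartialOrder Wedge.{u} where
  le p q := p = q ∨ q = top
  le_refl p := Or.inl rfl
  le_trans p q r := by rintro (rfl | rfl) (rfl | rfl) <;> simp
  le_antisymm p q := by rintro (rfl | rfl) (h | h) <;> simp_all

lemma le_iff {p q : Wedge.{u}} : p ≤ q ↔ p = q ∨ q = top := Iff.rfl

/-- The map out of `Wedge` given by two elements of a lattice. -/
def elim {L : Type*} [Top L] (a b : L) : Wedge.{u} → L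
  | top => ⊤
  | left => a
  | right => b

lemma elim_mono {L : Type*} [PartialOrder L] [OrderTop L] (a b : L) :
    Monotone (elim.{u} a b) := by
  rintro p q (rfl | rfl)
  · exact le_rfl
  · exact le_top

lemma iSup_elim {L : Type*} [CompleteLattice L] (a b : L) : ⨆ p, elim.{u} a b p = ⊤ :=
  top_le_iff.1 (le_iSup (elim.{u} a b) .top)

/-- This is flatness of `elim a b`. Disjointness matters only for `left` against `right`, which have
no common lower bound, so the join is empty. -/
lemma elim_inf_le {L : Type*} [CompleteLattice L] {a b : L} (h : Disjoint a b) (p q : Wedge.{u}) :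
    elim a b p ⊓ elim a b q ≤ ⨆ r : {r // r ≤ p ∧ r ≤ q}, elim a b r.1 := by
  have key (p q r : Wedge.{u}) (h₁ : r ≤ p) (h₂ : r ≤ q)
      (h : elim a b p ⊓ elim a b q ≤ elim a b r) :
      elim a b p ⊓ elim a b q ≤
        ⨆ r : {r // r ≤ p ∧ r ≤ q}, elim a b r.1 :=
    le_iSup_of_le (f := fun r : {r // r ≤ p ∧ r ≤ q} => elim a b r.1) ⟨r, h₁, h₂⟩ h
  have h0 : a ⊓ b = ⊥ := h.eq_bot
  rcases p with _ | _ | _ <;> rcases q with _ | _ | _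
  · exact key _ _ .top (.inl rfl) (.inl rfl) inf_le_left
  · exact key _ _ .left (.inr rfl) (.inl rfl) inf_le_right
  · exact key _ _ .right (.inr rfl) (.inl rfl) inf_le_right
  · exact key _ _ .left (.inl rfl) (.inr rfl) inf_le_left
  · exact key _ _ .left (.inl rfl) (.inl rfl) inf_le_left
  · exact h0.le.trans bot_le
  · exact key _ _ .right (.inl rfl) (.inr rfl) inf_le_left
  · exact (inf_comm b a ▸ h0).le.trans bot_le
  · exact key _ _ .right (.inl rfl) (.inl rfl) inf_le_left

end Wedge

/-- The locale whose maps from `X` are the pairs of disjoint opens of `X`. -/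
def disjointPairLocale : Locale.{u} := Locale.of (LowerSet Wedge.{u})

/-- The one-point locale. -/
def pointLocale : Locale.{u} := Locale.of (LowerSet PUnit.{u + 1})

namespace Locale

lemma hom_pointLocale_ext {X : Locale.{u}} (f g : X ⟶ pointLocale) : f = g := by
  have h : preimage f = preimage g := by
    refine frameHom_lowerSet_ext (P := PUnit.{u + 1}) (L := X) fun p => ?_
    have hp : LowerSet.Iic p = ⊤ := by ext; simp
    rw [hp]
    exact (map_top (preimage f)).trans (map_top (preimage g)).symm
  exact hom_ext fun b => DFunLike.congr_fun h b

/-- The map to the one-point locale. -/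
def toPoint (X : Locale.{u}) : X ⟶ pointLocale :=
  homOfPreimage (lowerSetLift (P := PUnit.{u + 1}) (L := X) (fun _ => ⊤) (by simp)
    (fun _ _ => le_iSup_of_le (f := fun _ => ⊤) ⟨PUnit.unit, by simp⟩ le_top))

variable {X Y : Locale.{u}}

/-- The map classifying a pair of disjoint opens. -/
def ofDisjoint (a b : X) (h : Disjoint a b) : X ⟶ disjointPairLocale :=
  homOfPreimage (lowerSetLift (P := Wedge.{u}) (L := X) (Wedge.elim a b)
    (Wedge.iSup_elim a b) (Wedge.elim_inf_le h))

/-- The first open classified by a map to `disjointPairLocale`. -/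
def leftOpen (f : X ⟶ disjointPairLocale.{u}) : X :=
  preimage f (LowerSet.Iic Wedge.left.{u} : LowerSet Wedge.{u})

/-- The second open classified by a map to `disjointPairLocale`. -/
def rightOpen (f : X ⟶ disjointPairLocale.{u}) : X :=
  preimage f (LowerSet.Iic Wedge.right.{u} : LowerSet Wedge.{u})

lemma disjoint_leftOpen_rightOpen (f : X ⟶ disjointPairLocale.{u}) :
    Disjoint (leftOpen f) (rightOpen f) := by
  have h : (LowerSet.Iic Wedge.left.{u} ⊓ LowerSet.Iic Wedge.right.{u} : LowerSet Wedge.{u}) = ⊥ := by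
    ext p
    simp only [LowerSet.mem_inf_iff, LowerSet.mem_Iic_iff, SetLike.mem_coe, LowerSet.notMem_bot,
      iff_false, Wedge.le_iff]
    rintro ⟨rfl | h, h' | h'⟩ <;> simp_all
  exact (disjoint_iff.2 h).frameHom_map (L := X) (preimage f)

@[simp]
lemma leftOpen_ofDisjoint (a b : X) (h : Disjoint a b) : leftOpen (ofDisjoint a b h) = a :=
  lowerSetLift_Iic (P := Wedge.{u}) (L := X) _ (Wedge.elim_mono a b) (Wedge.iSup_elim a b)
    (Wedge.elim_inf_le h) _

@[simp]
lemma rightOpen_ofDisjoint (a b : X) (h : Disjoint a b) : rightOpen (ofDisjoint a b h) = b :=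
  lowerSetLift_Iic (P := Wedge.{u}) (L := X) _ (Wedge.elim_mono a b) (Wedge.iSup_elim a b)
    (Wedge.elim_inf_le h) _

@[simp]
lemma leftOpen_comp (f : X ⟶ Y) (g : Y ⟶ disjointPairLocale.{u}) :
    leftOpen (f ≫ g) = preimage f (leftOpen g) := rfl

@[simp]
lemma rightOpen_comp (f : X ⟶ Y) (g : Y ⟶ disjointPairLocale.{u}) :
    rightOpen (f ≫ g) = preimage f (rightOpen g) := rfl

lemma hom_disjointPairLocale_ext {f g : X ⟶ disjointPairLocale.{u}}
    (hl : leftOpen f = leftOpen g) (hr : rightOpen f = rightOpen g) : f = g := by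
  have h : preimage f = preimage g := by
    refine frameHom_lowerSet_ext (P := Wedge.{u}) (L := X) fun p => ?_
    rcases p with _ | _ | _
    · have hp : LowerSet.Iic Wedge.top.{u} = ⊤ := by ext; simp [Wedge.le_iff]
      rw [hp]
      exact (map_top (preimage f)).trans (map_top (preimage g)).symm
    · exact hl
    · exact hr
  exact hom_ext fun b => DFunLike.congr_fun h b

end Locale

/-! ### Gluing opens over colimits and pushouts -/

namespace Locale

open Limits

variable {I : Type w} [Category.{v} I] {F : I ⥤ Locale.{u}} {c : Cocone F}

/-- Compatible pairs of disjoint opens glue to a pair of disjoint opens of a colimit. -/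
lemma exists_glue_disjoint (hc : IsColimit c) (a b : ∀ i, F.obj i)
    (hab : ∀ i, Disjoint (a i) (b i))
    (ha : ∀ ⦃i j⦄ (φ : i ⟶ j), preimage (F.map φ) (a j) = a i)
    (hb : ∀ ⦃i j⦄ (φ : i ⟶ j), preimage (F.map φ) (b j) = b i) :
    ∃ a' b' : c.pt, Disjoint a' b' ∧ (∀ i, preimage (c.ι.app i) a' = a i) ∧
      ∀ i, preimage (c.ι.app i) b' = b i := by
  let s : Cocone F :=
    { pt := disjointPairLocale
      ι :=
        { app i := ofDisjoint (a i) (b i) (hab i)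
          naturality i j φ := by
            refine (hom_disjointPairLocale_ext ?_ ?_).trans (Category.comp_id _).symm
            · simp [ha]
            · simp [hb] } }
  refine ⟨leftOpen (hc.desc s), rightOpen (hc.desc s), disjoint_leftOpen_rightOpen _,
    fun i => ?_, fun i => ?_⟩
  · rw [← leftOpen_comp, hc.fac, leftOpen_ofDisjoint]
  · rw [← rightOpen_comp, hc.fac, rightOpen_ofDisjoint]

lemma exists_glue (hc : IsColimit c) (a : ∀ i, F.obj i)
    (ha : ∀ ⦃i j⦄ (φ : i ⟶ j), preimage (F.map φ) (a j) = a i) :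
    ∃ a' : c.pt, ∀ i, preimage (c.ι.app i) a' = a i := by
  obtain ⟨a', -, -, h, -⟩ := exists_glue_disjoint hc a (fun _ => ⊥) (fun _ => disjoint_bot_right)
    ha (fun _ _ _ => map_bot _)
  exact ⟨a', h⟩

/-- An open `a` is encoded as the map classifying `(a, ⊥)`, and maps out of a colimit are determined
on the stages. -/
lemma eq_of_preimage_ι_eq (hc : IsColimit c) {a b : c.pt}
    (h : ∀ i, preimage (c.ι.app i) a = preimage (c.ι.app i) b) : a = b := by
  have : ofDisjoint a ⊥ disjoint_bot_right = ofDisjoint b ⊥ disjoint_bot_right :=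
    hc.hom_ext fun i => hom_disjointPairLocale_ext (by simpa using h i) (by simp)
  simpa using congrArg leftOpen this

lemma le_of_preimage_ι_le (hc : IsColimit c) {a b : c.pt}
    (h : ∀ i, preimage (c.ι.app i) a ≤ preimage (c.ι.app i) b) : a ≤ b :=
  inf_eq_left.1 (eq_of_preimage_ι_eq hc fun i => by rw [map_inf, inf_eq_left.2 (h i)])

section Pushout

variable {A A' B B' : Locale.{u}} {f : A ⟶ B} {h : A ⟶ A'} {f' : A' ⟶ B'} {t : B ⟶ B'}

lemma exists_glue_disjoint_of_isPushout (sq : IsPushout h f f' t)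
    {a₁ a₂ : A'} {b₁ b₂ : B} (ha : Disjoint a₁ a₂) (hb : Disjoint b₁ b₂)
    (h₁ : preimage h a₁ = preimage f b₁) (h₂ : preimage h a₂ = preimage f b₂) :
    ∃ c₁ c₂ : B', Disjoint c₁ c₂ ∧ preimage f' c₁ = a₁ ∧ preimage f' c₂ = a₂ ∧
      preimage t c₁ = b₁ ∧ preimage t c₂ = b₂ := by
  have w : h ≫ ofDisjoint a₁ a₂ ha = f ≫ ofDisjoint b₁ b₂ hb :=
    hom_disjointPairLocale_ext (by simpa using h₁) (by simpa using h₂)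
  let d := sq.desc _ _ w
  refine ⟨leftOpen d, rightOpen d, disjoint_leftOpen_rightOpen _, ?_, ?_, ?_, ?_⟩
  · rw [← leftOpen_comp, sq.inl_desc, leftOpen_ofDisjoint]
  · rw [← rightOpen_comp, sq.inl_desc, rightOpen_ofDisjoint]
  · rw [← leftOpen_comp, sq.inr_desc, leftOpen_ofDisjoint]
  · rw [← rightOpen_comp, sq.inr_desc, rightOpen_ofDisjoint]

lemma le_of_preimage_le_of_isPushout (sq : IsPushout h f f' t) {a b : B'}
    (h₁ : preimage f' a ≤ preimage f' b) (h₂ : preimage t a ≤ preimage t b) : a ≤ b := by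
  have : ofDisjoint (a ⊓ b) ⊥ disjoint_bot_right = ofDisjoint a ⊥ disjoint_bot_right :=
    sq.hom_ext (hom_disjointPairLocale_ext (by simpa using h₁) (by simp))
      (hom_disjointPairLocale_ext (by simpa using h₂) (by simp))
  exact inf_eq_left.1 (by simpa using congrArg leftOpen this)

end Pushout

end Locale

/-! ### Well-separated closed inclusions and their closure properties -/

namespace Locale

open Limits

/-- The maps along which pairs of disjoint opens extend to pairs of disjoint opens. -/
def extendsDisjoint : MorphismProperty Locale.{u} := fun A B f =>
  ∀ a₁ a₂ : A, Disjoint a₁ a₂ →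
    ∃ b₁ b₂ : B, Disjoint b₁ b₂ ∧ preimage f b₁ = a₁ ∧ preimage f b₂ = a₂

/-- Since disjoint pairs are maps to a classifying locale, extending them is a lifting problem. All
closure properties then come for free. -/
lemma extendsDisjoint_eq_llp :
    extendsDisjoint.{u} =
      (MorphismProperty.ofHoms fun _ : PUnit.{1} => toPoint disjointPairLocale.{u}).llp := by
  ext A B f
  rw [MorphismProperty.llp_ofHoms_iff_hasLiftingProperty]
  constructor
  · intro hf
    refine ⟨fun {g _} sq => ?_⟩
    obtain ⟨b₁, b₂, hb, h₁, h₂⟩ := hf _ _ (disjoint_leftOpen_rightOpen g)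
    exact ⟨⟨⟨ofDisjoint b₁ b₂ hb,
      hom_disjointPairLocale_ext (by simpa using h₁) (by simpa using h₂),
      hom_pointLocale_ext _ _⟩⟩⟩
  · intro hf a₁ a₂ ha
    have sq : CommSq (ofDisjoint a₁ a₂ ha) f (toPoint disjointPairLocale) (toPoint B) :=
      ⟨hom_pointLocale_ext _ _⟩
    refine ⟨leftOpen sq.lift, rightOpen sq.lift, disjoint_leftOpen_rightOpen _, ?_, ?_⟩
    · rw [← leftOpen_comp, sq.fac_left, leftOpen_ofDisjoint]
    · rw [← rightOpen_comp, sq.fac_left, rightOpen_ofDisjoint]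

instance : extendsDisjoint.{u}.IsStableUnderCobaseChange := by
  rw [extendsDisjoint_eq_llp]; infer_instance

instance : MorphismProperty.IsStableUnderCoproducts.{w} extendsDisjoint.{u} := by
  rw [extendsDisjoint_eq_llp]; infer_instance

instance : MorphismProperty.IsStableUnderTransfiniteComposition.{w} extendsDisjoint.{u} := by
  rw [extendsDisjoint_eq_llp]; infer_instance

instance : extendsDisjoint.{u}.IsMultiplicative := by
  rw [extendsDisjoint_eq_llp]; infer_instance

lemma extendsDisjoint.exists_preimage_eq {A B : Locale.{u}} {f : A ⟶ B} (hf : extendsDisjoint f)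
    (a : A) : ∃ b : B, preimage f b = a := by
  obtain ⟨b, -, -, h, -⟩ := hf a ⊥ disjoint_bot_right
  exact ⟨b, h⟩

/-- The union of the opens of `B` which are separated by opens from the image of `f : A ⟶ B`. -/
def separated {A B : Locale.{u}} (f : A ⟶ B) : B :=
  sSup {b | ∃ b' : B, Disjoint b b' ∧ preimage f b' = ⊤}

section

variable {A B C : Locale.{u}}

lemma le_separated {f : A ⟶ B} {b b' : B} (h : Disjoint b b') (h' : preimage f b' = ⊤) :
    b ≤ separated f := le_sSup ⟨b', h, h'⟩

lemma separated_le {f : A ⟶ B} {c : B}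
    (h : ∀ b b' : B, Disjoint b b' → preimage f b' = ⊤ → b ≤ c) : separated f ≤ c :=
  sSup_le fun b ⟨b', hb, hb'⟩ => h b b' hb hb'

lemma preimage_eq_bot_of_disjoint {f : A ⟶ B} {b b' : B} (h : Disjoint b b')
    (h' : preimage f b' = ⊤) : preimage f b = ⊥ := by
  have := congrArg (preimage f) h.eq_bot
  rwa [map_inf, h', inf_top_eq, map_bot] at this

lemma preimage_separated (f : A ⟶ B) : preimage f (separated f) = ⊥ := by
  rw [separated, map_sSup, sSup_image, ← le_bot_iff]
  exact iSup₂_le fun b ⟨b', hb, hb'⟩ => (preimage_eq_bot_of_disjoint hb hb').le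

lemma separated_comp_le (f : A ⟶ B) (g : B ⟶ C) : separated g ≤ separated (f ≫ g) :=
  separated_le fun b b' h h' => le_separated h (by simp [h'])

/-- A disjoint pair witnessing separation from `A` in `B` extends to such a pair in `C`. -/
lemma separated_le_preimage_separated_comp (f : A ⟶ B) {g : B ⟶ C} (hg : extendsDisjoint g) :
    separated f ≤ preimage g (separated (f ≫ g)) := by
  refine separated_le fun b b' h h' => ?_
  obtain ⟨c, c', hc, rfl, rfl⟩ := hg b b' h
  exact preimage_mono g (le_separated hc h')

end

/-- A class of well-separated closed inclusions of locales: disjoint opens extend along `f : A ⟶ B`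
to disjoint opens, and an open of `B` is determined, up to opens that are separated from `A`,
by its preimage under `f`. -/
def separatedClosed : MorphismProperty Locale.{u} := fun _ B f =>
  extendsDisjoint f ∧
    ∀ b b' : B, preimage f b ≤ preimage f b' → b ≤ b' ⊔ separated f

namespace separatedClosed

lemma comp {A B C : Locale.{u}} {f : A ⟶ B} {g : B ⟶ C} (hf : separatedClosed f)
    (hg : separatedClosed g) : separatedClosed (f ≫ g) := by
  refine ⟨extendsDisjoint.comp_mem _ _ hf.1 hg.1, fun c c' h => ?_⟩
  have h₁ := (hf.2 (preimage g c) (preimage g c') h).trans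
    (sup_le_sup_left (separated_le_preimage_separated_comp f hg.1) _)
  rw [← map_sup] at h₁
  refine (hg.2 _ _ h₁).trans ?_
  exact sup_le le_rfl ((separated_comp_le f g).trans le_sup_right)

instance : separatedClosed.{u}.IsMultiplicative where
  id_mem A := ⟨extendsDisjoint.id_mem A, fun _ _ h => le_sup_of_le_left h⟩
  comp_mem _ _ hf hg := comp hf hg

lemma of_isIso {A B : Locale.{u}} (f : A ⟶ B) [IsIso f] : separatedClosed f := by
  refine ⟨MorphismProperty.of_isIso _ f, fun b b' h => le_sup_of_le_left ?_⟩
  have := preimage_mono (inv f) h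
  rwa [← preimage_comp_apply, ← preimage_comp_apply, IsIso.inv_hom_id] at this

instance : separatedClosed.{u}.RespectsIso :=
  MorphismProperty.respectsIso_of_isStableUnderComposition fun _ _ f (_ : IsIso f) => of_isIso f

instance : separatedClosed.{u}.IsStableUnderCobaseChange where
  of_isPushout {A B A' B' f h f' t} sq hf := by
    refine ⟨MorphismProperty.of_isPushout sq hf.1, fun b b' hb => ?_⟩
    have w (x : B') : preimage h (preimage f' x) = preimage f (preimage t x) := by
      rw [← preimage_comp_apply, sq.w, preimage_comp_apply]
    refine le_of_preimage_le_of_isPushout sq (hb.trans (preimage_mono _ le_sup_left)) ?_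
    have hb' := hf.2 (preimage t b) (preimage t b') (by
      rw [← w, ← w]
      exact preimage_mono h hb)
    rw [map_sup]
    refine hb'.trans (sup_le_sup_left (separated_le fun v v' hv hv' => ?_) _)
    -- Gluing `v` with `⊥` and `v'` with `⊤` on `A'` makes `c'` contain all of `A'`.
    obtain ⟨c, c', hc, -, h₂, rfl, -⟩ := exists_glue_disjoint_of_isPushout sq
      (disjoint_bot_left (a := (⊤ : A'))) hv
      (by rw [map_bot, preimage_eq_bot_of_disjoint hv hv']) (by rw [map_top, hv'])
    exact preimage_mono t (le_separated hc h₂)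

lemma separated_le_preimage_ι {I : Type w} {F G : Discrete I ⥤ Locale.{u}} {c₁ : Cocone F}
    {c₂ : Cocone G} (h₁ : IsColimit c₁) (h₂ : IsColimit c₂) (α : F ⟶ G) (φ : c₁.pt ⟶ c₂.pt)
    (hφ : ∀ i, c₁.ι.app i ≫ φ = α.app i ≫ c₂.ι.app i) (i : Discrete I) :
    separated (α.app i) ≤ preimage (c₂.ι.app i) (separated φ) := by
  classical
  refine separated_le fun v v' hv hv' => ?_
  have compat (a : ∀ k, G.obj k) ⦃k l : Discrete I⦄ (ψ : k ⟶ l) :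
      preimage (G.map ψ) (a l) = a k := by
    obtain rfl : k = l := Discrete.ext (Discrete.eq_of_hom ψ)
    obtain rfl : ψ = 𝟙 k := Subsingleton.elim _ _
    rw [G.map_id, preimage_id_apply]
  -- Taking `(⊥, ⊤)` on the other summands makes `w'` contain the whole source coproduct.
  obtain ⟨w, w', hw, hwi, hwi'⟩ := exists_glue_disjoint h₂
    (Function.update (fun k => (⊥ : G.obj k)) i v) (Function.update (fun k => (⊤ : G.obj k)) i v')
    (fun k => by
      by_cases hk : k = i
      · subst hk; simpa using hv
      · simp [Function.update_of_ne hk])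
    (compat _) (compat _)
  have hφw : preimage φ w' = ⊤ := by
    refine eq_of_preimage_ι_eq h₁ fun k => ?_
    rw [← preimage_comp_apply, hφ, preimage_comp_apply, hwi', map_top]
    by_cases hk : k = i
    · subst hk; simpa using hv'
    · simp [Function.update_of_ne hk]
  have := preimage_mono (c₂.ι.app i) (le_separated hw hφw)
  rwa [hwi, Function.update_self] at this

instance : MorphismProperty.IsStableUnderCoproducts.{w} separatedClosed.{u} where
  isStableUnderCoproductsOfShape I :=
    { condition F G c₁ c₂ h₁ h₂ α hα φ hφ := by
        refine ⟨MorphismProperty.IsStableUnderColimitsOfShape.condition _ _ _ _ h₁ h₂ α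
          (fun i => (hα i).1) φ hφ, fun b b' hb => le_of_preimage_ι_le h₂ fun i => ?_⟩
        rw [map_sup]
        refine ((hα i).2 _ _ ?_).trans
          (sup_le_sup_left (separated_le_preimage_ι h₁ h₂ α φ hφ i) _)
        rw [← preimage_comp_apply, ← preimage_comp_apply, ← hφ]
        exact preimage_mono (c₁.ι.app i) hb }

lemma of_isColimit {J : Type w} [LinearOrder J] [OrderBot J] {F : J ⥤ Locale.{u}} {c : Cocone F}
    (hc : IsColimit c) (hF : ∀ j, separatedClosed (F.map (homOfLE (bot_le : ⊥ ≤ j))))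
    (hι : ∀ j, extendsDisjoint (c.ι.app j)) : separatedClosed (c.ι.app ⊥) := by
  refine ⟨hι ⊥, fun b b' h => le_of_preimage_ι_le hc fun j => ?_⟩
  have w : F.map (homOfLE (bot_le : ⊥ ≤ j)) ≫ c.ι.app j = c.ι.app ⊥ := c.w _
  rw [← w] at h ⊢
  rw [map_sup]
  exact ((hF j).2 _ _ h).trans
    (sup_le_sup_left (separated_le_preimage_separated_comp _ (hι j)) _)

instance : MorphismProperty.IsStableUnderTransfiniteComposition.{w} separatedClosed.{u} where
  isStableUnderTransfiniteCompositionOfShape J := by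
    intros
    refine ⟨fun X Y f ⟨h⟩ => ?_⟩
    let h' := h.ofLE (W' := extendsDisjoint) fun _ _ _ hf => hf.1
    have hF (j : J) : separatedClosed (h.F.map (homOfLE (bot_le : ⊥ ≤ j))) := by
      induction j using SuccOrder.limitRecOn with
      | isMin j hj =>
        obtain rfl := hj.eq_bot
        simpa using separatedClosed.id_mem _
      | succ j hj hj' =>
        rw [← homOfLE_comp bot_le (Order.le_succ j), h.F.map_comp]
        exact separatedClosed.comp_mem _ _ hj' (h.map_mem j hj)
      | isSuccLimit j hj hj' =>
        let : OrderBot (Set.Iio j) :=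
          { bot := ⟨⊥, Order.IsSuccLimit.bot_lt hj⟩
            bot_le j := bot_le }
        exact of_isColimit (h.F.isColimitOfIsWellOrderContinuous j hj)
          (fun k => hj' k.1 k.2) (fun k => h'.mem_map _)
    have hbot : separatedClosed (h.incl.app ⊥) :=
      of_isColimit h.isColimit hF fun j => h'.mem_incl_app j
    exact (MorphismProperty.arrow_mk_iso_iff _
      (Arrow.isoMk h.isoBot.symm (Iso.refl _))).2 hbot

end separatedClosed

end Locale

/-! ### Closed embeddings of spaces and the generating maps -/

namespace Locale

open Limits TopologicalSpace

lemma disjoint_coe_iff {X : Type*} [TopologicalSpace X] {a b : Opens X} :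
    Disjoint (a : Set X) b ↔ Disjoint a b := by
  rw [disjoint_iff, disjoint_iff, ← SetLike.coe_set_eq (p := a ⊓ b)]
  rfl

/-- Disjoint opens of a closed subspace of a completely normal space extend to disjoint opens. -/
lemma exists_disjoint_comap_eq {X Y : Type*} [TopologicalSpace X] [TopologicalSpace Y]
    [CompletelyNormalSpace Y] (f : C(X, Y)) (hf : Topology.IsClosedEmbedding f) (a₁ a₂ : Opens X)
    (ha : Disjoint a₁ a₂) :
    ∃ b₁ b₂ : Opens Y, Disjoint b₁ b₂ ∧ b₁.comap f = a₁ ∧ b₂.comap f = a₂ := by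
  have hcl (a b : Opens X) (hab : Disjoint (a : Set X) b) :
      Disjoint (closure (f '' a)) (f '' b) := by
    rw [hf.closure_image_eq]
    exact (Set.disjoint_image_iff hf.injective).2 (hab.closure_left b.2)
  obtain ⟨u₁, u₂, h₁, h₂, hs₁, hs₂, hu⟩ := separatedNhds_iff_disjoint.2
    (CompletelyNormalSpace.completely_normal (hcl a₁ a₂ (disjoint_coe_iff.2 ha))
      (hcl a₂ a₁ (disjoint_coe_iff.2 ha).symm).symm)
  have ext (a : Opens X) : ∃ v : Opens Y, v.comap f = a := by
    obtain ⟨v, hv, h⟩ := hf.isInducing.isOpen_iff.1 a.2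
    exact ⟨⟨v, hv⟩, Opens.ext h⟩
  obtain ⟨v₁, rfl⟩ := ext a₁
  obtain ⟨v₂, rfl⟩ := ext a₂
  -- The `u`'s give disjointness; the `v`'s cut the traces down to exactly the given opens.
  refine ⟨⟨u₁, h₁⟩ ⊓ v₁, ⟨u₂, h₂⟩ ⊓ v₂, ?_, ?_, ?_⟩
  · exact (disjoint_coe_iff.1 hu : Disjoint (⟨u₁, h₁⟩ : Opens Y) ⟨u₂, h₂⟩).mono inf_le_left
      inf_le_left
  · ext x
    exact ⟨fun h => h.2, fun h => ⟨hs₁ ⟨x, h, rfl⟩, h⟩⟩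
  · ext x
    exact ⟨fun h => h.2, fun h => ⟨hs₂ ⟨x, h, rfl⟩, h⟩⟩

/-- Regularity separates each point off the closed image from it, so `separated` contains the whole
complement. -/
lemma separatedClosed_topToLocale_map {X Y : TopCat.{u}} (f : X ⟶ Y)
    (hf : Topology.IsClosedEmbedding f) [CompletelyNormalSpace Y] [RegularSpace Y] :
    separatedClosed (topToLocale.map f) := by
  refine ⟨exists_disjoint_comap_eq f.hom hf, fun (b b' : Opens Y) h y hy => ?_⟩
  by_cases hyf : y ∈ Set.range f
  · obtain ⟨x, rfl⟩ := hyf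
    exact Or.inl (h hy)
  · have hd : Disjoint (nhdsSet {y}) (nhdsSet (Set.range f)) := by
      rw [nhdsSet_singleton]
      exact (RegularSpace.regular hf.isClosed_range hyf).symm
    obtain ⟨u, v, hu, hv, hyu, hfv, huv⟩ := separatedNhds_iff_disjoint.2 hd
    have hd' : Disjoint (⟨u, hu⟩ : Opens Y) ⟨v, hv⟩ := disjoint_coe_iff.1 huv
    have htop : Opens.comap f.hom ⟨v, hv⟩ = ⊤ := top_le_iff.1 fun x _ => hfv ⟨x, rfl⟩
    exact Or.inr (le_separated (f := topToLocale.map f) hd' htop (hyu rfl))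

lemma isClosedEmbedding_subspaceIncl {Y : Type} [TopologicalSpace Y] {S : Set Y}
    (hS : IsClosed S) : Topology.IsClosedEmbedding (subspaceIncl.{u} S) :=
  (Homeomorph.ulift.symm.isClosedEmbedding.comp hS.isClosedEmbedding_subtypeVal).comp
    Homeomorph.ulift.isClosedEmbedding

lemma separatedClosed_subspaceIncl {Y : Type} [MetricSpace Y] {S : Set Y} (hS : IsClosed S) :
    separatedClosed (topToLocale.map (subspaceIncl.{u} S)) :=
  separatedClosed_topToLocale_map _ (isClosedEmbedding_subspaceIncl hS)

lemma isClosed_cubeBoundary (n : ℕ) : IsClosed (Cube.boundary (Fin n)) := by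
  have : Cube.boundary (Fin n) = ⋃ i, {y | y i = 0 ∨ y i = 1} := by
    ext y
    simp [Cube.boundary]
  rw [this]
  exact isClosed_iUnion_of_finite fun i =>
    (isClosed_eq (continuous_apply i) continuous_const).union
      (isClosed_eq (continuous_apply i) continuous_const)

lemma locI_le : locI.{u} ≤ separatedClosed := by
  rintro _ _ _ ⟨n⟩
  exact separatedClosed_subspaceIncl (isClosed_cubeBoundary n)

lemma locJ_le : locJ.{u} ≤ separatedClosed := by
  rintro _ _ _ ⟨n⟩
  exact separatedClosed_subspaceIncl (isClosed_eq continuous_snd continuous_const)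

end Locale

lemma cell_le {C : Type u} [Category.{v} C] {W D : MorphismProperty C}
    [D.IsStableUnderCobaseChange] [MorphismProperty.IsStableUnderCoproducts.{w} D]
    [MorphismProperty.IsStableUnderTransfiniteComposition.{w} D] (h : W ≤ D) :
    cell.{w} W ≤ D := by
  simpa [cell] using h

/-! ### Covers of colimits, compactness and smallness -/

namespace Locale

open Limits TopologicalSpace

lemma preimage_finset_inf {A B : Locale.{u}} (f : A ⟶ B) {ι : Type*} (s : Finset ι) (N : ι → B) :
    preimage f (s.inf N) = s.inf fun m => preimage f (N m) :=
  map_finset_inf _ _ _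

/-- In the colimit of a sequence with a cofinal subsequence `j`, opens `N n` containing the
`j n`-th stages contain the terms of an increasing open cover. -/
lemma exists_cover_of_cofinal {J : Type w} [Preorder J] {F : J ⥤ Locale.{u}} {c : Cocone F}
    (hc : IsColimit c) (j : ℕ → J) (hj : Monotone j) (hcof : ∀ i, ∃ n, i ≤ j n) (N : ℕ → c.pt)
    (hN : ∀ n, preimage (c.ι.app (j n)) (N n) = ⊤) :
    ∃ V : ℕ → c.pt, Monotone V ∧ (∀ n, V n ≤ N n) ∧ ⨆ n, V n = ⊤ := by
  have htop {i : J} {m : ℕ} (h : i ≤ j m) : preimage (c.ι.app i) (N m) = ⊤ := by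
    rw [← c.w (homOfLE h), preimage_comp_apply]
    exact (congrArg _ (hN m)).trans (map_top _)
  -- On stage `i`, every `N m` with `m ≥ k` is `⊤`. The infinite meet of the `N m`, `m ≥ n`, is thus
  -- finite on each stage, and these finite meets glue to `V n`.
  have hle (n : ℕ) {i : J} {k k' : ℕ} (h : i ≤ j k) :
      preimage (c.ι.app i) ((Finset.Ico n k).inf N) ≤
        preimage (c.ι.app i) ((Finset.Ico n k').inf N) := by
    rw [preimage_finset_inf (B := c.pt), preimage_finset_inf (B := c.pt)]
    refine Finset.le_inf fun m hm => ?_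
    rcases lt_or_ge m k with hmk | hmk
    · exact Finset.inf_le (Finset.mem_Ico.2 ⟨(Finset.mem_Ico.1 hm).1, hmk⟩)
    · exact le_top.trans (htop (h.trans (hj hmk))).ge
  choose k hk using hcof
  have hglue (n : ℕ) : ∃ V : c.pt, ∀ i,
      preimage (c.ι.app i) V = preimage (c.ι.app i) ((Finset.Ico n (k i)).inf N) := by
    refine exists_glue hc _ fun i i' φ => ?_
    rw [← preimage_comp_apply, c.w]
    exact le_antisymm (hle n ((leOfHom φ).trans (hk i'))) (hle n (hk i))
  choose V hV using hglue
  refine ⟨V, fun n n' hn => ?_, fun n => ?_, top_le_iff.1 ?_⟩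
  · refine le_of_preimage_ι_le hc fun i => ?_
    rw [hV, hV]
    exact preimage_mono _ (Finset.inf_mono (Finset.Ico_subset_Ico_left hn))
  · refine le_of_preimage_ι_le hc fun i => ?_
    rw [hV]
    exact (hle n (k' := n + 1) (hk i)).trans
      (preimage_mono _ (Finset.inf_le (Finset.mem_Ico.2 ⟨le_rfl, n.lt_succ_self⟩)))
  · refine le_of_preimage_ι_le hc fun i => ?_
    have h : preimage (c.ι.app i) (V (k i)) = ⊤ := by
      rw [hV, Finset.Ico_self, Finset.inf_empty, map_top]
    rw [map_top, ← h]
    exact preimage_mono _ (le_iSup V _)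

lemma separatedClosed.exists_cover_of_preimage {A B : Locale.{u}} {f : A ⟶ B}
    (hf : separatedClosed f) (N : ℕ → B) (V : ℕ → A) (hV : Monotone V)
    (hVN : ∀ n, V n ≤ preimage f (N n)) (hV' : ⨆ n, V n = ⊤) :
    ∃ V' : ℕ → B, Monotone V' ∧ (∀ n, V' n ≤ N n ⊔ separated f) ∧ ⨆ n, V' n = ⊤ := by
  choose s hs using fun n => hf.1.exists_preimage_eq (V n)
  refine ⟨fun n => s n ⊔ separated f, fun n n' hn => ?_, fun n => ?_, ?_⟩
  · refine sup_le (hf.2 _ _ ?_) le_sup_right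
    rw [hs, hs]
    exact hV hn
  · refine sup_le (hf.2 _ _ ?_) le_sup_right
    rw [hs]
    exact hVN n
  · have h := hf.2 ⊤ (⨆ n, s n ⊔ separated f) (by
      rw [map_top, map_iSup]
      simp only [map_sup, preimage_separated, hs, sup_bot_eq]
      exact hV'.ge)
    rw [sup_of_le_left (le_iSup_of_le (f := fun n => s n ⊔ separated f) 0 le_sup_right)] at h
    exact top_le_iff.1 h

section

variable {J : Type w} [LinearOrder J] {F : J ⥤ Locale.{u}} {c : Cocone F}

lemma separated_ι_antitone {i j : J} (h : i ≤ j) :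
    separated (c.ι.app j) ≤ separated (c.ι.app i) := by
  rw [← c.w (homOfLE h)]
  exact separated_comp_le _ _

lemma exists_cover [WellFoundedLT J] [F.IsWellOrderContinuous]
    (hc : IsColimit c) (hι : ∀ i, separatedClosed (c.ι.app i)) (j : ℕ → J) (hj : StrictMono j)
    (N : ℕ → c.pt) (hN : ∀ n, preimage (c.ι.app (j n)) (N n) = ⊤) :
    ∃ V : ℕ → c.pt, Monotone V ∧ (∀ n, V n ≤ N n ⊔ separated (c.ι.app (j (n + 1)))) ∧
      ⨆ n, V n = ⊤ := by
  by_cases hcof : ∀ i, ∃ n, i ≤ j n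
  · obtain ⟨V, hV, hVN, hV'⟩ := exists_cover_of_cofinal hc j hj.monotone hcof N hN
    exact ⟨V, hV, fun n => le_sup_of_le_left (hVN n), hV'⟩
  push Not at hcof
  -- If `j` is bounded, its supremum `l` is a limit. The cover is built at stage `l`, the colimit of
  -- the earlier stages, and extended to `c.pt` at the cost of `separated (c.ι.app l)`.
  obtain ⟨l, hl, hmin⟩ := WellFounded.has_min (wellFounded_lt (α := J))
    {i | ∀ n, j n < i} hcof
  have hcofl (i : Set.Iio l) : ∃ n, i.1 ≤ j n := by
    by_contra! h
    exact hmin i.1 h i.2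
  have hlim : Order.IsSuccLimit l := by
    refine ⟨fun h => (hl 0).not_ge (h (hl 0).le), fun i hi => ?_⟩
    obtain ⟨n, hn⟩ := hcofl ⟨i, hi.lt⟩
    exact hi.2 (hn.trans_lt (hj n.lt_succ_self)) (hl _)
  obtain ⟨V, hV, hVN, hV'⟩ := exists_cover_of_cofinal
    (F.isColimitOfIsWellOrderContinuous l hlim) (fun n => ⟨j n, hl n⟩) hj.monotone hcofl
    (fun n => preimage (c.ι.app l) (N n)) (fun n => by
      refine Eq.trans ?_ (hN n)
      rw [← c.w (homOfLE (hl n).le)]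
      rfl)
  obtain ⟨V', h₁, h₂, h₃⟩ := (hι l).exists_cover_of_preimage N V hV hVN hV'
  refine ⟨V', h₁, fun n => (h₂ n).trans (sup_le le_sup_left ?_), h₃⟩
  exact (separated_ι_antitone (c := c) (hl (n + 1)).le).trans le_sup_right

section

variable {K : Type*} [TopologicalSpace K] {L : Type*} [Order.Frame L]

lemma exists_mem_of_mem_map_sSup (g : FrameHom L (Opens K)) {S : Set L} {x : K}
    (hx : x ∈ g (sSup S)) : ∃ V ∈ S, x ∈ g V := by
  rw [map_sSup, sSup_image] at hx
  obtain ⟨V, hx⟩ := Opens.mem_iSup.1 hx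
  obtain ⟨hV, hx⟩ := Opens.mem_iSup.1 hx
  exact ⟨V, hV, hx⟩

lemma notMem_map_of_disjoint (g : FrameHom L (Opens K)) {V N : L} (h : Disjoint V N) {x : K}
    (hx : x ∈ g V) : x ∉ g N := fun hN =>
  Set.disjoint_left.1 (disjoint_coe_iff.2 (h.frameHom_map g)) hx hN

end

lemma exists_notMem_map_separated {K : Type*} [TopologicalSpace K] (hc : IsColimit c)
    (g : FrameHom c.pt (Opens K)) (x : K) : ∃ i, x ∉ g (separated (c.ι.app i)) := by
  by_contra! h
  -- If `x` lay in every complement, each stage would be contained in an open whose preimage misses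
  -- `x`. The join of all such opens would then be `⊤`.
  let p : Set c.pt := {V | x ∉ g V}
  have hp : x ∉ g (sSup p) := fun hx => by
    obtain ⟨V, hV, hx⟩ := exists_mem_of_mem_map_sSup g hx
    exact hV hx
  have htop : sSup p = ⊤ := by
    refine eq_of_preimage_ι_eq hc fun i => ?_
    obtain ⟨V, ⟨V', hVV', hV'⟩, hi⟩ := exists_mem_of_mem_map_sSup g (h i)
    have hle : V' ≤ sSup p := le_sSup (notMem_map_of_disjoint g hVV' hi)
    rw [map_top, ← top_le_iff, ← hV']
    exact preimage_mono _ hle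
  rw [htop, map_top] at hp
  exact hp trivial

lemma exists_map_separated_eq_bot [OrderBot J] [WellFoundedLT J] [F.IsWellOrderContinuous]
    {K : Type*} [TopologicalSpace K] [CompactSpace K] (hc : IsColimit c)
    (hι : ∀ i, separatedClosed (c.ι.app i)) (g : FrameHom c.pt (Opens K)) :
    ∃ i, g (separated (c.ι.app i)) = ⊥ := by
  by_contra! h
  have mono {V V' : c.pt} (h : V ≤ V') : g V ≤ g V' := OrderHomClass.mono g h
  have step (i : J) : ∃ (k : J) (x : K) (N : c.pt), i < k ∧ preimage (c.ι.app i) N = ⊤ ∧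
      x ∉ g N ∧ x ∉ g (separated (c.ι.app k)) := by
    obtain ⟨x, hx⟩ : ∃ x, x ∈ g (separated (c.ι.app i)) := by
      by_contra! hx
      exact h i (le_bot_iff.1 fun x hx' => hx x hx')
    obtain ⟨k, hk⟩ := exists_notMem_map_separated hc g x
    have hik : i < k := by
      by_contra! hki
      exact hk (mono (separated_ι_antitone hki) hx)
    obtain ⟨V, ⟨N, hVN, hN⟩, hx⟩ := exists_mem_of_mem_map_sSup g hx
    exact ⟨k, x, N, hik, hN, notMem_map_of_disjoint g hVN hx, hk⟩
  choose next x N hnext hN hxN hx using step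
  let j (n : ℕ) : J := next^[n] ⊥
  have hj (n : ℕ) : j (n + 1) = next (j n) := Function.iterate_succ_apply' _ _ _
  obtain ⟨V, hV, hVN, hVtop⟩ := exists_cover hc hι j
    (strictMono_nat_of_lt_succ fun n => by rw [hj]; exact hnext _) (fun n => N (j n))
    (fun n => hN _)
  obtain ⟨n, hn⟩ : ∃ n, (Set.univ : Set K) ⊆ g (V n) := by
    refine isCompact_univ.elim_directed_cover (fun n => (g (V n) : Set K))
      (fun n => Opens.isOpen _) ?_ (Monotone.directed_le fun n n' hn => mono (hV hn))
    intro y _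
    have hy : y ∈ g (⨆ n, V n) := by
      rw [hVtop, map_top]
      trivial
    rw [map_iSup] at hy
    exact Set.mem_iUnion.2 (Opens.mem_iSup.1 hy)
  have hxn := mono (hVN n) (hn (Set.mem_univ (x (j n))))
  rw [map_sup, hj] at hxn
  exact hxn.elim (hxN _) (hx _)

end

/-- A map into `B` whose preimages kill the complement of `A` factors through `f : A ⟶ B`. -/
lemma separatedClosed.exists_lift {A B L : Locale.{u}} {f : A ⟶ B} (hf : separatedClosed f)
    (g : L ⟶ B) (hg : preimage g (separated f) = ⊥) : ∃ h : L ⟶ A, h ≫ f = g := by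
  have hle {b b' : B} (h : preimage f b ≤ preimage f b') : preimage g b ≤ preimage g b' := by
    simpa [hg] using preimage_mono g (hf.2 b b' h)
  have heq {b b' : B} (h : preimage f b = preimage f b') : preimage g b = preimage g b' :=
    le_antisymm (hle h.le) (hle h.ge)
  choose s hs using hf.1.exists_preimage_eq
  refine ⟨homOfPreimage
    { toFun a := preimage g (s a)
      map_inf' a a' := by
        rw [← map_inf]
        exact heq (by rw [map_inf, hs, hs, hs])
      map_top' := by
        rw [← map_top (preimage g)]
        exact heq (by rw [map_top, hs])
      map_sSup' S := by
        rw [← Function.comp_def (preimage g) s, Set.image_comp, ← map_sSup]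
        refine heq ?_
        rw [hs, map_sSup, ← Set.image_comp]
        simp [hs] }, hom_ext fun b => heq (hs _)⟩

/-- Surjectivity of `preimage f` makes `f` a monomorphism; this gives injectivity in the smallness
statement. -/
lemma extendsDisjoint.hom_ext {A B L : Locale.{u}} {f : A ⟶ B} (hf : extendsDisjoint f)
    {g h : L ⟶ A} (w : g ≫ f = h ≫ f) : g = h := by
  refine Locale.hom_ext fun a => ?_
  obtain ⟨b, rfl⟩ := hf.exists_preimage_eq a
  rw [← preimage_comp_apply, w, preimage_comp_apply]

lemma isOmegaSmallRelativeTo_of_le {D : MorphismProperty Locale.{u}} (hD : D ≤ separatedClosed)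
    (K : TopCat.{u}) [CompactSpace K] :
    IsOmegaSmallRelativeTo.{u} (topToLocale.obj K) D := by
  intro J _ _ _ _ _ F _ hF
  refine ⟨fun {c} hc => ⟨?_⟩⟩
  let h : separatedClosed.TransfiniteCompositionOfShape J (c.ι.app ⊥) :=
    { F := F
      isoBot := Iso.refl _
      incl := c.ι
      isColimit := hc
      map_mem := fun j _ => hD _ (hF j) }
  have hι (j : J) : separatedClosed (c.ι.app j) := h.mem_incl_app j
  refine Types.FilteredColimit.isColimitOf' _ _ (fun g => ?_) (fun i x y hxy => ?_)
  · obtain ⟨i, hi⟩ := exists_map_separated_eq_bot (K := K) hc hι (preimage g)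
    obtain ⟨k, hk⟩ := (hι i).exists_lift g hi
    exact ⟨i, k, hk.symm⟩
  · have hxy' : x = y := (hι i).1.hom_ext hxy
    exact ⟨i, 𝟙 i, by rw [hxy']⟩

end Locale

theorem mainTheorem11 :
    (∀ (K : Type u) [TopologicalSpace K] [CompactSpace K] [T2Space K],
      IsOmegaSmallRelativeTo.{u} (topToLocale.obj (TopCat.of K)) (cell.{u} locI.{u}) ∧
      IsOmegaSmallRelativeTo.{u} (topToLocale.obj (TopCat.of K)) (cell.{u} locJ.{u})) ∧
    (∀ n : ℕ,
      IsOmegaSmallRelativeTo.{u} (topToLocale.obj (cubeBoundaryTop.{u} n)) (cell.{u} locI.{u}) ∧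
      IsOmegaSmallRelativeTo.{u} (topToLocale.obj (cubeTop.{u} n)) (cell.{u} locJ.{u})) := by
  have hI : cell.{u} locI.{u} ≤ Locale.separatedClosed := cell_le Locale.locI_le
  have hJ : cell.{u} locJ.{u} ≤ Locale.separatedClosed := cell_le Locale.locJ_le
  refine ⟨fun K _ _ _ => ⟨Locale.isOmegaSmallRelativeTo_of_le hI _,
    Locale.isOmegaSmallRelativeTo_of_le hJ _⟩, fun n => ⟨?_, ?_⟩⟩
  · have : CompactSpace (cubeBoundaryTop.{u} n) := by
      have := isCompact_iff_compactSpace.1 (Locale.isClosed_cubeBoundary n).isCompact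
      infer_instance
    exact Locale.isOmegaSmallRelativeTo_of_le hI _
  · exact Locale.isOmegaSmallRelativeTo_of_le hJ _
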